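/- Fix an integer $m\ge 0$; polynomials have complex coefficients. For an integer $N\ge 2$ and $a>0$ let $S^{N-1}(a)$ be the sphere of radius $a$ centred at $0$ in $\mathbb R^N$. Let $q_m(a;X)=q_m^{(N)}(a;X)$ denote the monic one-variable polynomial of degree $m$ such that the harmonic polynomial in $X_1,\dots,X_N$ that coincides with $q_m(a;X_1)$ on $S^{N-1}(a)$ is homogeneous of degree $m$ (it generates the zonal harmonic of degree $m$ about the $X_1$-axis). For real $b>-\tfrac12$ let $C^{(b)}_m(y)$ denote the monic Gegenbauer polynomial, i.e. the monic polynomial of degree $m$ satisfying $$(1-y^2)p''(y)-(2b+1)\,y\,p'(y)+m(m+2b)\,p(y)=0 .$$ Let $H_m(X)$ be the (probabilists') Hermite polynomial; it is the component of $X^m$ orthogonal, in $L^2$ of the standard Gaussian measure on $\mathbb R$, to all polynomials of degree $<m$. Both $q_m(a;X)$ and $C_m^{(b)}$ exist and are unique, and, in the space of polynomials of degree $\le m$ (that is, coefficientwise), $$\lim_{N\to\infty} q_m(\sqrt N;X)=H_m(X).$$ Moreover $q_m(a;X)=a^m\,C_m^{((N-2)/2)}(X/a)$ for all $N\ge 2$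 and $a>0$, so that equivalently, in terms of the Gegenbauer polynomials rescaled to be monic in $X$, $$\lim_{N\to\infty} N^{m/2}\,C_m^{((N-2)/2)}\!\left(X/\sqrt N\right)=H_m(X).$$ -/

import Mathlib

open Filter Topology

noncomputable section

/-- The Euclidean Laplacian `∑ⱼ ∂ⱼ²` on polynomials in `N` variables. -/
def polyLaplacian {N : ℕ} (p : MvPolynomial (Fin N) ℂ) : MvPolynomial (Fin N) ℂ :=
  ∑ j : Fin N, MvPolynomial.pderiv j (MvPolynomial.pderiv j p)

/-- `h` is a harmonic polynomial which coincides, as a function, with `p` on the sphere of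
radius `a` centred at `0` in `ℝᴺ`. -/
def IsHarmonicRestriction {N : ℕ} (a : ℝ) (p h : MvPolynomial (Fin N) ℂ) : Prop :=
  polyLaplacian h = 0 ∧
    ∀ x : EuclideanSpace ℝ (Fin N), ‖x‖ = a →
      MvPolynomial.eval (fun j => (x j : ℂ)) h = MvPolynomial.eval (fun j => (x j : ℂ)) p

/-- `q` is the one-variable polynomial `q_m(a; X)` generating the zonal harmonic of degree `m`
about the `i`-th coordinate axis on the sphere of radius `a` in `ℝᴺ`: it is monic of degree `m`, and
the harmonic polynomial coinciding with `q(X_i)` on the sphere is homogeneous of degree `m`. -/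
def IsZonalGenerator {N : ℕ} (i : Fin N) (a : ℝ) (m : ℕ) (q : Polynomial ℂ) : Prop :=
  q.Monic ∧ q.natDegree = m ∧
    ∃ h : MvPolynomial (Fin N) ℂ,
      IsHarmonicRestriction a (Polynomial.aeval (MvPolynomial.X i) q) h ∧ h.IsHomogeneous m

/-- `p` is the monic Gegenbauer polynomial of degree `m` with parameter `b`: the monic polynomial
of degree `m` with `(1 - y²) p''(y) - (2b + 1) y p'(y) + m (m + 2b) p(y) = 0`. -/
def IsMonicGegenbauer (b : ℝ) (m : ℕ) (p : Polynomial ℂ) : Prop :=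
  p.Monic ∧ p.natDegree = m ∧
    (1 - Polynomial.X ^ 2) * Polynomial.derivative (Polynomial.derivative p)
      - Polynomial.C (2 * (b : ℂ) + 1) * Polynomial.X * Polynomial.derivative p
      + Polynomial.C ((m : ℂ) * ((m : ℂ) + 2 * (b : ℂ))) * p = 0

/-- `H` is the component of `X ^ m` orthogonal, in `L²` of the standard Gaussian measure on `ℝ`, to
all polynomials of degree less than `m`. -/
def IsGaussianOrthogonalComponent (m : ℕ) (H : Polynomial ℂ) : Prop :=
  (Polynomial.X ^ m - H).degree < (m : WithBot ℕ) ∧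
    ∀ p : Polynomial ℂ, p.degree < (m : WithBot ℕ) →
      ∫ x : ℝ, H.eval (x : ℂ) * starRingEnd ℂ (p.eval (x : ℂ))
        ∂(ProbabilityTheory.gaussianReal 0 1) = 0

/-- The Hermite polynomial `H_m` (monic, orthogonal for the standard Gaussian measure), with
complex coefficients. -/
def hermiteC (m : ℕ) : Polynomial ℂ :=
  (Polynomial.hermite m).map (Int.castRingHom ℂ)

/-- The polynomial `a ^ m * p(X / a)`. When `p` is monic of degree `m` and `a ≠ 0`, this is `p(X / a)`
rescaled so as to be monic in `X`. -/
def dilate (a : ℝ) (m : ℕ) (p : Polynomial ℂ) : Polynomial ℂ :=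
  Polynomial.C ((a : ℂ) ^ m) * p.comp (Polynomial.C ((a : ℂ)⁻¹) * Polynomial.X)

/-- Coefficientwise convergence of polynomials. For polynomials of bounded degree `≤ m` this is
convergence in the finite-dimensional vector space of polynomials of degree `≤ m`. -/
def PolyTendsto (p : ℕ → Polynomial ℂ) (q : Polynomial ℂ) : Prop :=
  ∀ k : ℕ, Tendsto (fun N => (p N).coeff k) atTop (𝓝 (q.coeff k))

end

/-! All the families involved satisfy one kind of coefficient recurrence, `(j + 2)(j + 1) p_{j+2} +
u_j p_j = 0`. If `u_j ≠ 0` for `j < m`, a monic solution of degree `m` is determined from the top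
coefficient down and depends continuously on `u`. The Gegenbauer equation gives `u_j = (m - j)(m + j
+ 2b)`, the Hermite equation gives `u_j = m - j`, and dilation by `a` divides `u` by `a²`. For `2b =
N - 2` and `a² = N` the quotient tends to `m - j`, which is the limit theorem.

The geometric input is `isZonalGenerator_iff`. Homogeneity forces `q` to have the parity of `m`, so
each term of `q(X_i)` can be padded by powers of `∑ X_j² / a²` to degree `m`. A homogeneous
polynomial is determined by its values on a sphere, so the result is the only possible `h`. On the
sphere, its Laplacian is a multiple of the Gegenbauer operator applied to `q`
(`eval_polyLaplacian_homogeneousExtension`). Gaussian orthogonality of `H_m` is integration by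
parts. -/

/-! ### Two-step coefficient recurrences -/

/-- `p` is monic of degree `m`, and its coefficients satisfy the two-step recurrence
`(j + 2) (j + 1) p_{j+2} + u_j p_j = 0`. -/
structure IsRecurrenceSolution (m : ℕ) (u : ℕ → ℂ) (p : Polynomial ℂ) : Prop where
  monic : p.Monic
  natDegree_eq : p.natDegree = m
  recurrence : ∀ j : ℕ, ((j : ℂ) + 2) * ((j : ℂ) + 1) * p.coeff (j + 2) + u j * p.coeff j = 0

/-- Descending induction on the coefficient index: `p_j = -(j + 2)(j + 1) p_{j+2} / u_j` is
continuous in `p_{j+2}` and `u_j` near `v_j ≠ 0`. The coefficients of index at least `m` are fixed.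
-/
theorem IsRecurrenceSolution.polyTendsto {m : ℕ} {u : ℕ → ℕ → ℂ} {v : ℕ → ℂ}
    {p : ℕ → Polynomial ℂ} {q : Polynomial ℂ}
    (hp : ∀ᶠ n in atTop, IsRecurrenceSolution m (u n) (p n)) (hq : IsRecurrenceSolution m v q)
    (hv : ∀ j < m, v j ≠ 0) (huv : ∀ j < m, Tendsto (fun n => u n j) atTop (𝓝 (v j))) :
    PolyTendsto p q := by
  have large : ∀ j, m ≤ j → Tendsto (fun n => (p n).coeff j) atTop (𝓝 (q.coeff j)) := by
    intro j hj
    refine tendsto_const_nhds.congr' ?_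
    filter_upwards [hp] with n hn
    rcases hj.eq_or_lt with rfl | hj
    · have h₁ := hq.monic.coeff_natDegree
      have h₂ := hn.monic.coeff_natDegree
      rw [hq.natDegree_eq] at h₁
      rw [hn.natDegree_eq] at h₂
      rw [h₁, h₂]
    · rw [Polynomial.coeff_eq_zero_of_natDegree_lt (hq.natDegree_eq.trans_lt hj),
        Polynomial.coeff_eq_zero_of_natDegree_lt (hn.natDegree_eq.trans_lt hj)]
  have main : ∀ i j, m ≤ j + i → Tendsto (fun n => (p n).coeff j) atTop (𝓝 (q.coeff j)) := by
    intro i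
    induction i using Nat.strong_induction_on with
    | _ i ih =>
      intro j hj
      rcases le_or_gt m j with hmj | hmj
      · exact large j hmj
      have next : Tendsto (fun n => (p n).coeff (j + 2)) atTop (𝓝 (q.coeff (j + 2))) := by
        rcases le_or_gt m (j + 2) with h | h
        · exact large _ h
        · exact ih (i - 2) (by omega) (j + 2) (by omega)
      have hquot := ((next.const_mul (((j : ℂ) + 2) * ((j : ℂ) + 1))).neg).div (huv j hmj) (hv j hmj)
      have hval : q.coeff j = -(((j : ℂ) + 2) * ((j : ℂ) + 1) * q.coeff (j + 2)) / v j := by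
        rw [eq_div_iff (hv j hmj)]
        linear_combination hq.recurrence j
      rw [hval]
      refine hquot.congr' ?_
      -- Only the limit `v j` is assumed nonzero; `u n j` is then nonzero for large `n`.
      filter_upwards [hp, (huv j hmj).eventually_ne (hv j hmj)] with n hn hne
      rw [Pi.div_apply, div_eq_iff hne]
      linear_combination -hn.recurrence j
  exact fun j => main m j (by omega)

/-- Convergence of a constant sequence of solutions to another solution forces equality. -/
theorem IsRecurrenceSolution.unique {m : ℕ} {u : ℕ → ℂ} {p q : Polynomial ℂ}
    (hp : IsRecurrenceSolution m u p) (hq : IsRecurrenceSolution m u q)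
    (hu : ∀ j < m, u j ≠ 0) : p = q := by
  have h := IsRecurrenceSolution.polyTendsto (u := fun _ => u) (p := fun _ => p)
    (Eventually.of_forall fun _ => hp) hq hu fun _ _ => tendsto_const_nhds
  ext j
  exact tendsto_nhds_unique tendsto_const_nhds (h j)

/-- The coefficients, from the top down, of the solution of the two-step recurrence. -/
noncomputable def descendingCoeff (m : ℕ) (u : ℕ → ℂ) : ℕ → ℂ
  | 0 => 1
  | 1 => 0
  | i + 2 => -(((m - i : ℕ) : ℂ) * ((m - i - 1 : ℕ) : ℂ) * descendingCoeff m u i) / u (m - i - 2)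

theorem exists_isRecurrenceSolution {m : ℕ} {u : ℕ → ℂ} (hu : ∀ j < m, u j ≠ 0) (hm : u m = 0) :
    ∃ p, IsRecurrenceSolution m u p := by
  set d := descendingCoeff m u with hd
  set p : Polynomial ℂ :=
    ∑ j ∈ Finset.range (m + 1), Polynomial.monomial j (d (m - j)) with hp
  have hcoeff : ∀ j, p.coeff j = if j ≤ m then d (m - j) else 0 := by
    intro j
    simp [hp, Polynomial.coeff_monomial]
  have htop : p.coeff m = 1 := by simp [hcoeff, hd, descendingCoeff]
  have hdeg : p.natDegree ≤ m := by
    rw [Polynomial.natDegree_le_iff_coeff_eq_zero]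
    intro j hj
    simp [hcoeff, hj.not_ge]
  refine ⟨p, Polynomial.monic_of_natDegree_le_of_coeff_eq_one m hdeg htop,
    Polynomial.natDegree_eq_of_le_of_coeff_ne_zero hdeg (by simp [htop]), fun j => ?_⟩
  rcases le_or_gt (j + 2) m with h | h
  · obtain ⟨i, rfl⟩ := Nat.exists_eq_add_of_le h
    have h₁ : j + 2 + i - j = i + 2 := by omega
    have h₂ : j + 2 + i - i = j + 2 := by omega
    have hne := hu j (by omega)
    rw [hcoeff, hcoeff, if_pos h, if_pos (by omega), h₁, Nat.add_sub_cancel_left, hd,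
      descendingCoeff, h₂]
    simp only [Nat.add_sub_cancel, show j + 2 - 1 = j + 1 by omega]
    push_cast
    field_simp
    ring
  · rw [hcoeff (j + 2), if_neg (by omega), hcoeff]
    split_ifs with hj
    -- Boundary cases, where `p_{j+2} = 0`: at `j = m` the relation needs `u m = 0`, and at `j = m -
    -- 1` it holds because the second coefficient from the top is `0`.
    · rcases (show j = m ∨ m = j + 1 by omega) with rfl | rfl
      · simp [hm]
      · simp [hd, descendingCoeff]
    · simp

theorem IsRecurrenceSolution.coeff_eq_zero_of_odd {m : ℕ} {u : ℕ → ℂ} {p : Polynomial ℂ}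
    (hp : IsRecurrenceSolution m u p) (hu : ∀ j < m, u j ≠ 0) {j : ℕ} (hj : Odd (m + j)) :
    p.coeff j = 0 := by
  have main : ∀ k j, j + (2 * k + 1) = m → p.coeff j = 0 := by
    intro k
    induction k with
    | zero =>
      intro j hj
      have h := hp.recurrence j
      rw [Polynomial.coeff_eq_zero_of_natDegree_lt (n := j + 2)
        (by rw [hp.natDegree_eq]; omega), mul_zero, zero_add] at h
      exact (mul_eq_zero.mp h).resolve_left (hu j (by omega))
    | succ k ih =>
      intro j hj
      have h := hp.recurrence j
      rw [ih (j + 2) (by omega), mul_zero, zero_add] at h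
      exact (mul_eq_zero.mp h).resolve_left (hu j (by omega))
  rcases le_or_gt j m with h | h
  · obtain ⟨k, hk⟩ := hj
    exact main ((m - j) / 2) j (by omega)
  · exact Polynomial.coeff_eq_zero_of_natDegree_lt (hp.natDegree_eq.trans_lt h)

/-- The `j`-th coefficient is scaled by `a ^ (m - j)`, so a shift of `j` by two costs a factor `a²`.
-/
theorem isRecurrenceSolution_dilate {m : ℕ} {u : ℕ → ℂ} {p : Polynomial ℂ}
    (hp : IsRecurrenceSolution m u p) {a : ℝ} (ha : a ≠ 0) :
    IsRecurrenceSolution m (fun j => u j / (a : ℂ) ^ 2) (dilate a m p) := by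
  have ha' : (a : ℂ) ≠ 0 := by exact_mod_cast ha
  have hcoeff : ∀ j, (dilate a m p).coeff j = (a : ℂ) ^ m * (p.coeff j * (a : ℂ)⁻¹ ^ j) := by
    intro j
    rw [dilate, Polynomial.coeff_C_mul, Polynomial.comp_C_mul_X_coeff]
  have htop : (dilate a m p).coeff m = 1 := by
    have h := hp.monic.coeff_natDegree
    rw [hp.natDegree_eq] at h
    rw [hcoeff, h, one_mul, ← mul_pow, mul_inv_cancel₀ ha', one_pow]
  have hdeg : (dilate a m p).natDegree ≤ m := by
    rw [Polynomial.natDegree_le_iff_coeff_eq_zero]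
    intro j hj
    rw [hcoeff, Polynomial.coeff_eq_zero_of_natDegree_lt (hp.natDegree_eq.trans_lt hj)]
    simp
  refine ⟨Polynomial.monic_of_natDegree_le_of_coeff_eq_one m hdeg htop,
    Polynomial.natDegree_eq_of_le_of_coeff_ne_zero hdeg (by simp [htop]), fun j => ?_⟩
  rw [hcoeff, hcoeff]
  have h := hp.recurrence j
  rw [pow_add]
  simp only [div_eq_mul_inv, inv_pow]
  linear_combination (a : ℂ) ^ m * ((a : ℂ) ^ j)⁻¹ * ((a : ℂ) ^ 2)⁻¹ * h

/-! ### The Gegenbauer operator -/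

/-- The differential operator `p ↦ (A - X²) p'' - B X p' + M p`. -/
noncomputable def gegenbauerOp (A B M : ℂ) : Polynomial ℂ →ₗ[ℂ] Polynomial ℂ :=
  LinearMap.mulLeft ℂ (Polynomial.C A - Polynomial.X ^ 2) ∘ₗ Polynomial.derivative ∘ₗ
      Polynomial.derivative
    - LinearMap.mulLeft ℂ (Polynomial.C B * Polynomial.X) ∘ₗ Polynomial.derivative
    + LinearMap.mulLeft ℂ (Polynomial.C M)

theorem gegenbauerOp_apply (A B M : ℂ) (p : Polynomial ℂ) :
    gegenbauerOp A B M p =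
      (Polynomial.C A - Polynomial.X ^ 2) * Polynomial.derivative (Polynomial.derivative p)
      - Polynomial.C B * Polynomial.X * Polynomial.derivative p + Polynomial.C M * p := rfl

theorem coeff_gegenbauerOp (A B M : ℂ) (p : Polynomial ℂ) (j : ℕ) :
    (gegenbauerOp A B M p).coeff j =
      A * (((j : ℂ) + 2) * ((j : ℂ) + 1) * p.coeff (j + 2))
        + (M - (j : ℂ) * ((j : ℂ) - 1) - B * (j : ℂ)) * p.coeff j := by
  rw [gegenbauerOp_apply, sub_mul, mul_assoc (Polynomial.C B), pow_two, mul_assoc Polynomial.X]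
  rcases j with _ | _ | j
  · simp [Polynomial.coeff_derivative, mul_comm, one_add_one_eq_two]
  · simp [Polynomial.coeff_derivative, Polynomial.coeff_X_mul]
    ring
  · simp [Polynomial.coeff_derivative, Polynomial.coeff_X_mul]
    ring

/-- Comparison of coefficients, using `m(m + 2b) - j(j - 1) - (2b + 1)j = (m - j)(m + j + 2b)`. -/
theorem isRecurrenceSolution_iff_gegenbauerOp {m : ℕ} {A b : ℂ} (hA : A ≠ 0) {p : Polynomial ℂ} :
    IsRecurrenceSolution m (fun j => ((m : ℂ) - j) * ((m : ℂ) + j + 2 * b) / A) p ↔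
      p.Monic ∧ p.natDegree = m ∧
        gegenbauerOp A (2 * b + 1) ((m : ℂ) * ((m : ℂ) + 2 * b)) p = 0 := by
  have key : ∀ j : ℕ, (gegenbauerOp A (2 * b + 1) ((m : ℂ) * ((m : ℂ) + 2 * b)) p).coeff j =
      A * (((j : ℂ) + 2) * ((j : ℂ) + 1) * p.coeff (j + 2)
        + ((m : ℂ) - j) * ((m : ℂ) + j + 2 * b) / A * p.coeff j) := by
    intro j
    rw [coeff_gegenbauerOp]
    field_simp
    ring
  constructor
  · rintro ⟨h₁, h₂, h₃⟩
    refine ⟨h₁, h₂, Polynomial.ext fun j => ?_⟩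
    rw [key, h₃ j, mul_zero, Polynomial.coeff_zero]
  · rintro ⟨h₁, h₂, h₃⟩
    refine ⟨h₁, h₂, fun j => ?_⟩
    have h := key j
    rw [h₃, Polynomial.coeff_zero] at h
    exact (mul_eq_zero.mp h.symm).resolve_left hA

theorem isMonicGegenbauer_iff {b : ℝ} {m : ℕ} {p : Polynomial ℂ} :
    IsMonicGegenbauer b m p ↔
      IsRecurrenceSolution m (fun j => ((m : ℂ) - j) * ((m : ℂ) + j + 2 * (b : ℂ)) / 1) p := by
  rw [isRecurrenceSolution_iff_gegenbauerOp one_ne_zero, gegenbauerOp_apply, Polynomial.C_1,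
    IsMonicGegenbauer]

theorem gegenbauer_recurrence_ne_zero {b : ℝ} (hb : -(1 / 2) < b) {m j : ℕ} (hj : j < m) {A : ℂ}
    (hA : A ≠ 0) : ((m : ℂ) - j) * ((m : ℂ) + j + 2 * (b : ℂ)) / A ≠ 0 := by
  refine div_ne_zero (mul_ne_zero ?_ ?_) hA
  · exact sub_ne_zero.mpr (by exact_mod_cast hj.ne')
  · have h₁ : (1 : ℝ) ≤ m := by exact_mod_cast (by omega : 1 ≤ m)
    have h₂ : (0 : ℝ) ≤ j := j.cast_nonneg
    have h₃ : (m : ℝ) + j + 2 * b ≠ 0 := ne_of_gt (by linarith)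
    exact_mod_cast h₃

/-! ### Hermite polynomials and Gaussian orthogonality -/

theorem derivative_hermite_succ (n : ℕ) :
    Polynomial.derivative (Polynomial.hermite (n + 1)) = ((n : Polynomial ℤ) + 1) * Polynomial.hermite n := by
  induction n with
  | zero => simp
  | succ n ih =>
    rw [Polynomial.hermite_succ (n + 1), Polynomial.derivative_sub, Polynomial.derivative_mul, ih]
    have h : Polynomial.derivative (((n : Polynomial ℤ) + 1) * Polynomial.hermite n) =
        ((n : Polynomial ℤ) + 1) * Polynomial.derivative (Polynomial.hermite n) := by
      simp [Polynomial.derivative_mul]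
    rw [h, Polynomial.derivative_X]
    have h' := Polynomial.hermite_succ n
    push_cast
    linear_combination -((n : Polynomial ℤ) + 1) * h'

/-- This is `H'' - X H' + m H = 0` read on coefficients, obtained from `H_{n+1}' = (n + 1) H_n` and
`H_{n+1} = X H_n - H_n'`. -/
theorem hermite_recurrence (m j : ℕ) :
    ((j : ℤ) + 2) * ((j : ℤ) + 1) * (Polynomial.hermite m).coeff (j + 2)
      + ((m : ℤ) - j) * (Polynomial.hermite m).coeff j = 0 := by
  rcases m with _ | n
  · rcases j with _ | j <;> simp [Polynomial.hermite_zero, Polynomial.coeff_one]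
  have hder : ∀ k : ℕ, (Polynomial.hermite (n + 1)).coeff (k + 1) * ((k : ℤ) + 1) =
      ((n : ℤ) + 1) * (Polynomial.hermite n).coeff k := by
    intro k
    have h := congrArg (fun p => Polynomial.coeff p k) (derivative_hermite_succ n)
    rw [← Nat.cast_succ, ← Polynomial.C_eq_natCast, Polynomial.coeff_C_mul,
      Polynomial.coeff_derivative] at h
    simpa using h
  rcases j with _ | j
  · have h := hder 1
    have h' := Polynomial.coeff_hermite_succ_zero n
    push_cast at h ⊢
    linear_combination h + ((n : ℤ) + 1) * h'
  · have h₀ := hder j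
    have h₂ := hder (j + 2)
    have h' := Polynomial.coeff_hermite_succ_succ n j
    push_cast at h₂ ⊢
    linear_combination ((j : ℤ) + 2) * h₂ - h₀ + ((n : ℤ) + 1) * h'

theorem hermiteC_isRecurrenceSolution (m : ℕ) :
    IsRecurrenceSolution m (fun j => (m : ℂ) - j) (hermiteC m) where
  monic := (Polynomial.hermite_monic m).map _
  natDegree_eq := by
    rw [hermiteC, (Polynomial.hermite_monic m).natDegree_map, Polynomial.natDegree_hermite]
  recurrence j := by
    have h := congrArg (Int.castRingHom ℂ) (hermite_recurrence m j)
    simpa [hermiteC] using h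

theorem hermiteC_succ (n : ℕ) :
    hermiteC (n + 1) = Polynomial.X * hermiteC n - Polynomial.derivative (hermiteC n) := by
  simp [hermiteC, Polynomial.hermite_succ, Polynomial.derivative_map]

open MeasureTheory ProbabilityTheory in
theorem integrable_eval_gaussianReal (μ : ℝ) (v : NNReal) (p : Polynomial ℂ) :
    Integrable (fun x : ℝ => p.eval (x : ℂ)) (gaussianReal μ v) := by
  induction p using Polynomial.induction_on' with
  | add p q hp hq => simpa only [Polynomial.eval_add] using hp.fun_add hq
  | monomial n c =>
    simp only [Polynomial.eval_monomial]
    refine Integrable.const_mul ?_ c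
    have h := (memLp_id_gaussianReal (μ := μ) (v := v) n).integrable_norm_pow'
    refine h.mono (by fun_prop) (ae_of_all _ fun x => ?_)
    simp

open MeasureTheory ProbabilityTheory in
-- For the Gaussian density `φ`, `φ' = -x φ`, so the integrand times `φ` is `-(φ p)'`.
theorem integral_gaussianReal_X_mul_sub_derivative (p : Polynomial ℂ) :
    ∫ x : ℝ, (Polynomial.X * p - Polynomial.derivative p).eval (x : ℂ) ∂(gaussianReal 0 1) = 0 := by
  have hint : ∀ q : Polynomial ℂ,
      Integrable (fun x : ℝ => gaussianPDFReal 0 1 x • q.eval (x : ℂ)) := by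
    intro q
    have h := integrable_eval_gaussianReal 0 1 q
    rw [gaussianReal_of_var_ne_zero _ one_ne_zero,
      integrable_withDensity_iff_integrable_smul' (measurable_gaussianPDF _ _)
        (ae_of_all _ fun _ => gaussianPDF_lt_top)] at h
    simpa [toReal_gaussianPDF] using h
  have hpdf : ∀ x : ℝ, HasDerivAt (gaussianPDFReal 0 1) (-x * gaussianPDFReal 0 1 x) x := by
    intro x
    have h : HasDerivAt (fun y : ℝ => -(y - 0) ^ 2 / (2 * ((1 : NNReal) : ℝ))) (-x) x :=
      ((((hasDerivAt_id x).sub_const 0).pow 2).neg.div_const (2 * ((1 : NNReal) : ℝ))).congr_deriv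
        (by simp; ring)
    refine (h.exp.const_mul (Real.sqrt (2 * Real.pi * ((1 : NNReal) : ℝ)))⁻¹).congr_deriv ?_
    simp only [gaussianPDFReal]
    ring
  have hp : ∀ x : ℝ, HasDerivAt (fun y : ℝ => p.eval (y : ℂ))
      ((Polynomial.derivative p).eval (x : ℂ)) x := fun x =>
    (p.hasDerivAt (x : ℂ)).comp_ofReal
  rw [integral_gaussianReal_eq_integral_smul one_ne_zero, ← neg_eq_zero, ← integral_neg]
  refine integral_eq_zero_of_hasDerivAt_of_integrable
    (f := fun x : ℝ => gaussianPDFReal 0 1 x • p.eval (x : ℂ)) (fun x => ?_) (hint _).neg (hint _)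
  refine ((hpdf x).smul (hp x)).congr_deriv ?_
  simp only [Polynomial.eval_sub, Polynomial.eval_mul, Polynomial.eval_X, Complex.real_smul]
  push_cast
  ring

open MeasureTheory ProbabilityTheory in
-- `H ↦ X H - H'` is adjoint to differentiation; iterating it kills every `p` of degree less than
-- `m`.
theorem integral_hermiteC_succ_mul (n : ℕ) (p : Polynomial ℂ) :
    ∫ x : ℝ, (hermiteC (n + 1) * p).eval (x : ℂ) ∂(gaussianReal 0 1) =
      ∫ x : ℝ, (hermiteC n * Polynomial.derivative p).eval (x : ℂ) ∂(gaussianReal 0 1) := by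
  rw [← sub_eq_zero, ← integral_sub (integrable_eval_gaussianReal _ _ _)
    (integrable_eval_gaussianReal _ _ _),
    ← integral_gaussianReal_X_mul_sub_derivative (hermiteC n * p)]
  congr 1
  ext x
  rw [← Polynomial.eval_sub, hermiteC_succ, Polynomial.derivative_mul]
  congr 1
  ring

open ProbabilityTheory in
theorem integral_hermiteC_mul_eq_zero (m : ℕ) (p : Polynomial ℂ) (hp : p.degree < m) :
    ∫ x : ℝ, (hermiteC m * p).eval (x : ℂ) ∂(gaussianReal 0 1) = 0 := by
  induction m generalizing p with
  | zero =>
    have : p = 0 := by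
      rw [← Polynomial.degree_eq_bot]
      exact (Nat.WithBot.lt_zero_iff).mp (by simpa using hp)
    simp [this]
  | succ m ih =>
    rw [integral_hermiteC_succ_mul]
    refine ih _ ?_
    rw [Polynomial.degree_lt_iff_coeff_zero] at hp ⊢
    intro k hk
    rw [Polynomial.coeff_derivative, hp (k + 1) (by omega), zero_mul]

theorem hermiteC_isGaussianOrthogonalComponent (m : ℕ) :
    IsGaussianOrthogonalComponent m (hermiteC m) := by
  have h := hermiteC_isRecurrenceSolution m
  refine ⟨?_, fun p hp => ?_⟩
  · have := Polynomial.degree_sub_lt_left (p := (Polynomial.X ^ m : Polynomial ℂ)) (q := hermiteC m)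
      (by rw [Polynomial.degree_X_pow, Polynomial.degree_eq_natDegree h.monic.ne_zero,
        h.natDegree_eq]) (Polynomial.monic_X_pow m).ne_zero
      (by rw [(Polynomial.monic_X_pow m).leadingCoeff, h.monic.leadingCoeff])
    simpa using this
  -- At real points, conjugating the value of `p` amounts to conjugating its coefficients.
  · have key := integral_hermiteC_mul_eq_zero m (p.map (starRingEnd ℂ))
      (by rwa [Polynomial.degree_map])
    rw [← key]
    congr 1
    ext x
    rw [Polynomial.eval_mul, ← Complex.conj_ofReal x, Polynomial.eval_map_apply]
    simp

/-! ### Laplacians of `X_i ^ n (∑ X_j²) ^ k` -/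

/-- The quadratic form `∑ⱼ Xⱼ²` as a polynomial. -/
noncomputable def normSqPoly (N : ℕ) : MvPolynomial (Fin N) ℂ := ∑ j : Fin N, MvPolynomial.X j ^ 2

theorem polyLaplacian_sum {N : ℕ} {ι : Type*} (s : Finset ι) (f : ι → MvPolynomial (Fin N) ℂ) :
    polyLaplacian (∑ k ∈ s, f k) = ∑ k ∈ s, polyLaplacian (f k) := by
  simp only [polyLaplacian, map_sum]
  exact Finset.sum_comm

theorem polyLaplacian_C_mul {N : ℕ} (c : ℂ) (f : MvPolynomial (Fin N) ℂ) :
    polyLaplacian (MvPolynomial.C c * f) = MvPolynomial.C c * polyLaplacian f := by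
  simp only [polyLaplacian, MvPolynomial.pderiv_C_mul, Finset.mul_sum]

theorem polyLaplacian_mul {N : ℕ} (f g : MvPolynomial (Fin N) ℂ) :
    polyLaplacian (f * g) = f * polyLaplacian g
      + 2 * ∑ j, MvPolynomial.pderiv j f * MvPolynomial.pderiv j g + polyLaplacian f * g := by
  simp only [polyLaplacian, Finset.mul_sum, Finset.sum_mul, ← Finset.sum_add_distrib]
  refine Finset.sum_congr rfl fun j _ => ?_
  simp only [MvPolynomial.pderiv_mul, map_add]
  ring

theorem pderiv_X_pow_same {N : ℕ} (i : Fin N) (n : ℕ) :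
    MvPolynomial.pderiv i (MvPolynomial.X i ^ n : MvPolynomial (Fin N) ℂ) =
      MvPolynomial.C (n : ℂ) * MvPolynomial.X i ^ (n - 1) := by
  simp

theorem pderiv_X_pow_of_ne {N : ℕ} {i j : Fin N} (h : i ≠ j) (n : ℕ) :
    MvPolynomial.pderiv j (MvPolynomial.X i ^ n : MvPolynomial (Fin N) ℂ) = 0 := by
  simp [MvPolynomial.pderiv_X_of_ne h]

theorem pderiv_normSqPoly {N : ℕ} (j : Fin N) :
    MvPolynomial.pderiv j (normSqPoly N) = 2 * MvPolynomial.X j := by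
  rw [normSqPoly, map_sum, Finset.sum_eq_single j]
  · simp
  · intro k _ hk
    exact pderiv_X_pow_of_ne hk 2
  · simp

theorem pderiv_normSqPoly_pow {N : ℕ} (j : Fin N) (k : ℕ) :
    MvPolynomial.pderiv j (normSqPoly N ^ k) =
      MvPolynomial.C (2 * (k : ℂ)) * (MvPolynomial.X j * normSqPoly N ^ (k - 1)) := by
  rw [MvPolynomial.pderiv_pow, pderiv_normSqPoly, map_mul, map_ofNat, map_natCast]
  ring

theorem polyLaplacian_X_pow {N : ℕ} (i : Fin N) (n : ℕ) :
    polyLaplacian (MvPolynomial.X i ^ n : MvPolynomial (Fin N) ℂ) =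
      MvPolynomial.C ((n : ℂ) * ((n : ℂ) - 1)) * MvPolynomial.X i ^ (n - 2) := by
  rw [polyLaplacian, Finset.sum_eq_single i]
  · rw [pderiv_X_pow_same, MvPolynomial.pderiv_C_mul, pderiv_X_pow_same, ← mul_assoc,
      ← map_mul, Nat.sub_sub]
    rcases n with _ | n <;> simp
  · intro j _ hj
    rw [pderiv_X_pow_of_ne hj.symm, map_zero]
  · simp

theorem polyLaplacian_normSqPoly_pow (N k : ℕ) :
    polyLaplacian (normSqPoly N ^ k) =
      MvPolynomial.C (2 * (k : ℂ) * ((N : ℂ) + 2 * ((k : ℂ) - 1))) * normSqPoly N ^ (k - 1) := by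
  have hterm : ∀ j : Fin N,
      MvPolynomial.pderiv j (MvPolynomial.pderiv j (normSqPoly N ^ k)) =
        MvPolynomial.C (2 * (k : ℂ)) * normSqPoly N ^ (k - 1)
        + MvPolynomial.C (2 * (k : ℂ)) * MvPolynomial.C (2 * ((k - 1 : ℕ) : ℂ)) *
          normSqPoly N ^ (k - 1 - 1) * MvPolynomial.X j ^ 2 := by
    intro j
    rw [pderiv_normSqPoly_pow, MvPolynomial.pderiv_C_mul, MvPolynomial.pderiv_mul,
      MvPolynomial.pderiv_X_self, pderiv_normSqPoly_pow]
    ring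
  rw [polyLaplacian, Finset.sum_congr rfl fun j _ => hterm j, Finset.sum_add_distrib,
    ← Finset.mul_sum, ← Finset.mul_sum,
    show ∑ j : Fin N, MvPolynomial.X j ^ 2 = normSqPoly N from rfl]
  simp only [Finset.sum_const, Finset.card_univ, Fintype.card_fin, nsmul_eq_mul]
  -- The truncated exponents `k - 1` and `k - 1 - 1` are harmless: their coefficients vanish for
  -- small `k`.
  rcases k with _ | _ | k
  · simp
  · simp
  · simp [pow_succ]
    ring

theorem polyLaplacian_X_pow_mul_normSqPoly_pow {N : ℕ} (i : Fin N) (n k : ℕ) :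
    polyLaplacian (MvPolynomial.X i ^ n * normSqPoly N ^ k) =
      MvPolynomial.C ((n : ℂ) * ((n : ℂ) - 1)) * (MvPolynomial.X i ^ (n - 2) * normSqPoly N ^ k)
      + MvPolynomial.C (2 * (k : ℂ) * (2 * (n : ℂ) + (N : ℂ) + 2 * ((k : ℂ) - 1))) *
        (MvPolynomial.X i ^ n * normSqPoly N ^ (k - 1)) := by
  have hcross : ∑ j, MvPolynomial.pderiv j (MvPolynomial.X i ^ n : MvPolynomial (Fin N) ℂ) *
      MvPolynomial.pderiv j (normSqPoly N ^ k) =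
        MvPolynomial.C (2 * (k : ℂ) * (n : ℂ)) *
          (MvPolynomial.X i ^ n * normSqPoly N ^ (k - 1)) := by
    rw [Finset.sum_eq_single i]
    · rw [pderiv_X_pow_same, pderiv_normSqPoly_pow]
      rcases n with _ | n
      · simp
      · simp [pow_succ]
        ring
    · intro j _ hj
      rw [pderiv_X_pow_of_ne hj.symm, zero_mul]
    · simp
  rw [polyLaplacian_mul, hcross, polyLaplacian_X_pow, polyLaplacian_normSqPoly_pow]
  simp only [map_add, map_mul, map_sub, map_ofNat, map_one]
  ring

/-! ### Homogeneous polynomials and values on spheres -/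

theorem isHomogeneous_normSqPoly (N : ℕ) : (normSqPoly N).IsHomogeneous 2 :=
  MvPolynomial.IsHomogeneous.sum _ _ _ fun j _ => MvPolynomial.isHomogeneous_X_pow j 2

theorem isHomogeneous_polyLaplacian {N n : ℕ} {f : MvPolynomial (Fin N) ℂ}
    (hf : f.IsHomogeneous n) : (polyLaplacian f).IsHomogeneous (n - 1 - 1) :=
  MvPolynomial.IsHomogeneous.sum _ _ _ fun _ _ => hf.pderiv.pderiv

theorem eval_normSqPoly {N : ℕ} (x : EuclideanSpace ℝ (Fin N)) :
    MvPolynomial.eval (fun j => (x j : ℂ)) (normSqPoly N) = ((‖x‖ ^ 2 : ℝ) : ℂ) := by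
  rw [EuclideanSpace.norm_sq_eq, normSqPoly]
  simp

theorem MvPolynomial.IsHomogeneous.eval_mul_left {σ R : Type*} [CommSemiring R] {n : ℕ}
    {f : MvPolynomial σ R} (hf : f.IsHomogeneous n) (c : R) (x : σ → R) :
    MvPolynomial.eval (fun j => c * x j) f = c ^ n * MvPolynomial.eval x f := by
  rw [MvPolynomial.eval_eq, MvPolynomial.eval_eq, Finset.mul_sum]
  refine Finset.sum_congr rfl fun d hd => ?_
  have hdeg : ∑ j ∈ d.support, d j = n := by
    have h := hf (MvPolynomial.mem_support_iff.mp hd)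
    rwa [Finsupp.weight_apply, Finsupp.sum, Finset.sum_congr rfl fun j _ => by
      rw [Pi.one_apply, smul_eq_mul, mul_one]] at h
  simp only [mul_pow, Finset.prod_mul_distrib, Finset.prod_pow_eq_pow_sum, hdeg]
  ring

/-- A homogeneous polynomial vanishing on a real sphere of positive radius is zero. -/
theorem eq_zero_of_isHomogeneous_of_sphere {N : ℕ} (i : Fin N) {n : ℕ}
    {f : MvPolynomial (Fin N) ℂ} (hf : f.IsHomogeneous n) {a : ℝ} (ha : 0 < a)
    (h : ∀ x : EuclideanSpace ℝ (Fin N), ‖x‖ = a →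
      MvPolynomial.eval (fun j => (x j : ℂ)) f = 0) : f = 0 := by
  -- It suffices to test on the infinite grid of real points with all coordinates nonzero. The index
  -- `i` guarantees that such a point is not the origin, so it can be rescaled to the sphere.
  refine MvPolynomial.funext_set (fun _ => Complex.ofReal '' {0}ᶜ)
    (fun _ => ((Set.finite_singleton (0 : ℝ)).infinite_compl).image
      Complex.ofReal_injective.injOn) fun z hz => ?_
  choose y hy hyz using fun j => hz j (Set.mem_univ j)
  obtain rfl : (fun j => (y j : ℂ)) = z := funext hyz
  set x : EuclideanSpace ℝ (Fin N) := WithLp.toLp 2 y with hx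
  have hx0 : x ≠ 0 := fun h0 => hy i (congrArg (fun v : EuclideanSpace ℝ (Fin N) => v i) h0)
  have hnorm : ‖x‖ ≠ 0 := norm_ne_zero_iff.mpr hx0
  have hscale : ‖(a / ‖x‖) • x‖ = a := by
    rw [norm_smul, Real.norm_of_nonneg (by positivity), div_mul_cancel₀ _ hnorm]
  have hval := h _ hscale
  have heq : (fun j => (((a / ‖x‖) • x) j : ℂ)) = fun j => ((a / ‖x‖ : ℝ) : ℂ) * (y j : ℂ) := by
    ext j
    simp [hx]
  rw [heq, hf.eval_mul_left] at hval
  rw [map_zero]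
  refine (mul_eq_zero.mp hval).resolve_left (pow_ne_zero _ ?_)
  exact_mod_cast div_ne_zero ha.ne' hnorm

/-- A second axis, available since `N ≥ 2`, supplies the missing length `√(a² - t²)`. -/
theorem exists_sphere_point {N : ℕ} (hN : 2 ≤ N) (i : Fin N) {a t : ℝ} (ht : |t| ≤ a) :
    ∃ x : EuclideanSpace ℝ (Fin N), ‖x‖ = a ∧ x i = t := by
  have : Nontrivial (Fin N) := Fin.nontrivial_iff_two_le.mpr hN
  obtain ⟨k, hk⟩ := exists_ne i
  have hsq : t ^ 2 ≤ a ^ 2 := sq_le_sq' (neg_le_of_abs_le ht) (le_of_abs_le ht)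
  refine ⟨EuclideanSpace.single i t + EuclideanSpace.single k (Real.sqrt (a ^ 2 - t ^ 2)), ?_, ?_⟩
  · have hinner : inner ℝ (EuclideanSpace.single i t)
        (EuclideanSpace.single k (Real.sqrt (a ^ 2 - t ^ 2))) = 0 := by
      simp [EuclideanSpace.inner_single_left, hk.symm]
    have h := norm_add_sq_eq_norm_sq_add_norm_sq_of_inner_eq_zero _ _ hinner
    rw [← sq_eq_sq₀ (norm_nonneg _) ((abs_nonneg t).trans ht), sq, h]
    simp only [PiLp.norm_single, Real.norm_eq_abs, abs_mul_abs_self]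
    rw [Real.mul_self_sqrt (by linarith)]
    ring
  · simp [hk.symm]

theorem Polynomial.eq_zero_of_sphere {N : ℕ} (hN : 2 ≤ N) (i : Fin N) {a : ℝ} (ha : 0 < a)
    {q : Polynomial ℂ} (h : ∀ x : EuclideanSpace ℝ (Fin N), ‖x‖ = a → q.eval (x i : ℂ) = 0) :
    q = 0 := by
  refine Polynomial.eq_zero_of_infinite_isRoot q
    (((Set.Icc_infinite (neg_lt_self ha)).image Complex.ofReal_injective.injOn).mono ?_)
  rintro _ ⟨t, ht, rfl⟩
  obtain ⟨x, hx, rfl⟩ := exists_sphere_point hN i (abs_le.mpr ht)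
  exact h x hx

theorem eq_sum_monomial_of_parity {m : ℕ} {q : Polynomial ℂ} (hdeg : q.natDegree ≤ m)
    (hpar : ∀ j, Odd (m + j) → q.coeff j = 0) :
    q = ∑ k ∈ Finset.range (m / 2 + 1), Polynomial.monomial (m - 2 * k) (q.coeff (m - 2 * k)) := by
  ext j
  simp only [Polynomial.finsetSum_coeff, Polynomial.coeff_monomial]
  rcases Nat.even_or_odd (m + j) with he | ho
  · rcases le_or_gt j m with hj | hj
    · obtain ⟨l, hl⟩ := he
      rw [Finset.sum_eq_single (l - j), if_pos (by omega)]
      · congr 1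
        omega
      · intro k hk hne
        rw [Finset.mem_range] at hk
        exact if_neg (by omega)
      · intro hl'
        rw [Finset.mem_range] at hl'
        omega
    · rw [Polynomial.coeff_eq_zero_of_natDegree_lt (hdeg.trans_lt hj)]
      exact (Finset.sum_eq_zero fun k _ => if_neg (by omega)).symm
  · rw [hpar j ho]
    refine (Finset.sum_eq_zero fun k hk => if_neg fun hkj => ?_).symm
    obtain ⟨l, hl⟩ := ho
    rw [Finset.mem_range] at hk
    omega

/-! ### Homogeneous extension and the zonal equation -/

/-- The homogeneous extension of degree `m` of the restriction of `q(Xᵢ)` to the sphere of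
radius `a`, for `q` of degree at most `m` and of the parity of `m`. -/
noncomputable def homogeneousExtension {N : ℕ} (i : Fin N) (a : ℝ) (m : ℕ) (q : Polynomial ℂ) :
    MvPolynomial (Fin N) ℂ :=
  ∑ k ∈ Finset.range (m / 2 + 1), MvPolynomial.C (q.coeff (m - 2 * k) / (a : ℂ) ^ (2 * k)) *
    (MvPolynomial.X i ^ (m - 2 * k) * normSqPoly N ^ k)

theorem isHomogeneous_homogeneousExtension {N : ℕ} (i : Fin N) (a : ℝ) (m : ℕ)
    (q : Polynomial ℂ) : (homogeneousExtension i a m q).IsHomogeneous m := by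
  refine MvPolynomial.IsHomogeneous.sum _ _ _ fun k hk => MvPolynomial.IsHomogeneous.C_mul ?_ _
  have h := (MvPolynomial.isHomogeneous_X_pow (R := ℂ) i (m - 2 * k)).mul
    ((isHomogeneous_normSqPoly N).pow k)
  rw [Finset.mem_range] at hk
  rwa [show m - 2 * k + 2 * k = m by omega] at h

theorem eval_homogeneousExtension {N : ℕ} (i : Fin N) {a : ℝ} (ha : 0 < a) {m : ℕ}
    {q : Polynomial ℂ} (hdeg : q.natDegree ≤ m) (hpar : ∀ j, Odd (m + j) → q.coeff j = 0)
    {x : EuclideanSpace ℝ (Fin N)} (hx : ‖x‖ = a) :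
    MvPolynomial.eval (fun j => (x j : ℂ)) (homogeneousExtension i a m q) = q.eval (x i : ℂ) := by
  have ha' : (a : ℂ) ≠ 0 := by exact_mod_cast ha.ne'
  conv_rhs => rw [eq_sum_monomial_of_parity hdeg hpar]
  rw [homogeneousExtension, map_sum, Polynomial.eval_finsetSum]
  refine Finset.sum_congr rfl fun k _ => ?_
  rw [map_mul, map_mul, map_pow, map_pow, MvPolynomial.eval_C, MvPolynomial.eval_X,
    eval_normSqPoly, hx, Polynomial.eval_monomial]
  push_cast
  rw [← pow_mul]
  field_simp

/-- Checked on each monomial `X ^ n` with `m = n + 2k`: the second-derivative term matches `a² p''`,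
and the other coefficient satisfies `2k(2n + N + 2(k - 1)) = m(m + N - 2) - n(n - 1) - (N - 1)n`. -/
theorem eval_polyLaplacian_homogeneousExtension {N : ℕ} (i : Fin N) {a : ℝ} (ha : 0 < a) {m : ℕ}
    {q : Polynomial ℂ} (hdeg : q.natDegree ≤ m) (hpar : ∀ j, Odd (m + j) → q.coeff j = 0)
    {x : EuclideanSpace ℝ (Fin N)} (hx : ‖x‖ = a) :
    (a : ℂ) ^ 2 * MvPolynomial.eval (fun j => (x j : ℂ))
        (polyLaplacian (homogeneousExtension i a m q)) =
      (gegenbauerOp ((a : ℂ) ^ 2) ((N : ℂ) - 1) ((m : ℂ) * ((m : ℂ) + (N : ℂ) - 2)) q).eval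
        (x i : ℂ) := by
  have ha' : (a : ℂ) ≠ 0 := by exact_mod_cast ha.ne'
  conv_rhs => rw [eq_sum_monomial_of_parity hdeg hpar]
  rw [homogeneousExtension, polyLaplacian_sum, map_sum, map_sum, Polynomial.eval_finsetSum,
    Finset.mul_sum]
  refine Finset.sum_congr rfl fun k hk => ?_
  obtain ⟨n, hn⟩ : ∃ n, m = n + 2 * k := by
    rw [Finset.mem_range] at hk
    exact ⟨m - 2 * k, by omega⟩
  subst hn
  rw [polyLaplacian_C_mul, polyLaplacian_X_pow_mul_normSqPoly_pow, gegenbauerOp_apply]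
  simp only [Nat.add_sub_cancel, map_mul, map_add, map_pow, MvPolynomial.eval_C,
    MvPolynomial.eval_X, eval_normSqPoly, hx, Polynomial.eval_monomial,
    Polynomial.derivative_monomial, Polynomial.eval_mul, Polynomial.eval_add, Polynomial.eval_sub,
    Polynomial.eval_C, Polynomial.eval_X, Polynomial.eval_pow]
  set c := q.coeff n
  set t : ℂ := (x i : ℂ)
  -- Splitting off small `k` and `n` resolves the truncated exponents.
  rcases k with _ | k <;> rcases n with _ | _ | n <;>
    simp only [Nat.add_sub_cancel, Nat.zero_sub, zero_add, Nat.sub_self] <;> push_cast <;>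
    field_simp <;> ring

theorem neg_half_lt_gegenbauer_parameter {N : ℕ} (hN : 2 ≤ N) :
    -(1 / 2 : ℝ) < ((N : ℝ) - 2) / 2 := by
  have : (2 : ℝ) ≤ N := by exact_mod_cast hN
  linarith

theorem isZonalGenerator_iff {N : ℕ} (hN : 2 ≤ N) (i : Fin N) {a : ℝ} (ha : 0 < a) {m : ℕ}
    {q : Polynomial ℂ} :
    IsZonalGenerator i a m q ↔ IsRecurrenceSolution m
      (fun j => ((m : ℂ) - j) * ((m : ℂ) + j + 2 * ((((N : ℝ) - 2) / 2 : ℝ) : ℂ)) / (a : ℂ) ^ 2)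
      q := by
  have ha' : (a : ℂ) ^ 2 ≠ 0 := pow_ne_zero 2 (by exact_mod_cast ha.ne')
  have hb := neg_half_lt_gegenbauer_parameter hN
  have h₁ : 2 * ((((N : ℝ) - 2) / 2 : ℝ) : ℂ) + 1 = (N : ℂ) - 1 := by
    push_cast
    ring
  have h₂ : (m : ℂ) * ((m : ℂ) + 2 * ((((N : ℝ) - 2) / 2 : ℝ) : ℂ)) =
      (m : ℂ) * ((m : ℂ) + (N : ℂ) - 2) := by
    push_cast
    ring
  have heval : ∀ x : EuclideanSpace ℝ (Fin N),
      MvPolynomial.eval (fun j => (x j : ℂ)) (Polynomial.aeval (MvPolynomial.X i) q) =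
        q.eval (x i : ℂ) := by
    intro x
    rw [Polynomial.aeval_def, Polynomial.hom_eval₂, MvPolynomial.eval_X, Polynomial.eval]
    congr 1
    ext c
    simp
  constructor
  · rintro ⟨hmon, hdeg, h, ⟨hharm, hres⟩, hhom⟩
    refine (isRecurrenceSolution_iff_gegenbauerOp ha').mpr ⟨hmon, hdeg, ?_⟩
    -- The antipodal map preserves the sphere and multiplies `h` by `(-1) ^ m`; hence `q` has the
    -- parity of `m`.
    have hsymm : q.comp (-Polynomial.X) - Polynomial.C ((-1 : ℂ) ^ m) * q = 0 := by
      refine Polynomial.eq_zero_of_sphere hN i ha fun x hx => ?_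
      have hneg := hres (-x) (by rw [norm_neg, hx])
      have hodd := hhom.eval_mul_left (-1) (fun j => (x j : ℂ))
      rw [heval] at hneg
      simp only [PiLp.neg_apply, Complex.ofReal_neg] at hneg
      simp only [neg_one_mul] at hodd
      rw [hodd, hres x hx, heval] at hneg
      simp [hneg]
    have hpar : ∀ j, Odd (m + j) → q.coeff j = 0 := by
      intro j hj
      have hc := congrArg (fun p => Polynomial.coeff p j) hsymm
      rw [show (-Polynomial.X : Polynomial ℂ) = Polynomial.C (-1) * Polynomial.X by simp] at hc
      simp only [Polynomial.coeff_sub, Polynomial.comp_C_mul_X_coeff, Polynomial.coeff_C_mul,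
        Polynomial.coeff_zero] at hc
      rcases Nat.even_or_odd m with hm | hm
      · have hj' : Odd j := (Nat.odd_add.mp hj).not.mp (by simpa using hm) |> Nat.not_even_iff_odd.mp
        rw [hm.neg_one_pow, hj'.neg_one_pow] at hc
        linear_combination (-1 / 2 : ℂ) * hc
      · have hj' : Even j := (Nat.odd_add.mp hj).mp hm
        rw [hm.neg_one_pow, hj'.neg_one_pow] at hc
        linear_combination (1 / 2 : ℂ) * hc
    -- Both sides are homogeneous of degree `m` and agree on the sphere.
    have heq : homogeneousExtension i a m q = h := by
      rw [← sub_eq_zero]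
      refine eq_zero_of_isHomogeneous_of_sphere i
        ((isHomogeneous_homogeneousExtension i a m q).sub hhom) ha fun x hx => ?_
      rw [map_sub, eval_homogeneousExtension i ha hdeg.le hpar hx, hres x hx, heval, sub_self]
    rw [h₁, h₂]
    refine Polynomial.eq_zero_of_sphere hN i ha fun x hx => ?_
    rw [← eval_polyLaplacian_homogeneousExtension i ha hdeg.le hpar hx, heq, hharm, map_zero,
      mul_zero]
  · intro hrec
    have hpar : ∀ j, Odd (m + j) → q.coeff j = 0 := fun j hj =>
      hrec.coeff_eq_zero_of_odd (fun _ hj => gegenbauer_recurrence_ne_zero hb hj ha') hj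
    obtain ⟨hmon, hdeg, hop⟩ := (isRecurrenceSolution_iff_gegenbauerOp ha').mp hrec
    rw [h₁, h₂] at hop
    have hhom := isHomogeneous_homogeneousExtension i a m q
    refine ⟨hmon, hdeg, homogeneousExtension i a m q, ⟨?_, fun x hx => ?_⟩, hhom⟩
    -- The Laplacian is again homogeneous, so its vanishing on the sphere, given by the differential
    -- equation, makes it zero.
    · refine eq_zero_of_isHomogeneous_of_sphere i (isHomogeneous_polyLaplacian hhom) ha
        fun x hx => ?_
      have key := eval_polyLaplacian_homogeneousExtension i ha hdeg.le hpar hx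
      rw [hop, Polynomial.eval_zero] at key
      exact (mul_eq_zero.mp key).resolve_left ha'
    · rw [heval, eval_homogeneousExtension i ha hdeg.le hpar hx]

theorem existsUnique_isZonalGenerator {N : ℕ} (hN : 2 ≤ N) (i : Fin N) {a : ℝ} (ha : 0 < a)
    (m : ℕ) : ∃! q, IsZonalGenerator i a m q := by
  have ha' : (a : ℂ) ^ 2 ≠ 0 := pow_ne_zero 2 (by exact_mod_cast ha.ne')
  simp only [isZonalGenerator_iff hN i ha]
  have hu := fun (j : ℕ) (hj : j < m) =>
    gegenbauer_recurrence_ne_zero (neg_half_lt_gegenbauer_parameter hN) hj ha'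
  obtain ⟨q, hq⟩ := exists_isRecurrenceSolution hu (by simp)
  exact ⟨q, hq, fun p hp => IsRecurrenceSolution.unique hp hq hu⟩

theorem existsUnique_isMonicGegenbauer {b : ℝ} (hb : -(1 / 2) < b) (m : ℕ) :
    ∃! p, IsMonicGegenbauer b m p := by
  simp only [isMonicGegenbauer_iff]
  have hu := fun (j : ℕ) (hj : j < m) => gegenbauer_recurrence_ne_zero hb hj one_ne_zero
  obtain ⟨q, hq⟩ := exists_isRecurrenceSolution hu (by simp)
  exact ⟨q, hq, fun p hp => IsRecurrenceSolution.unique hp hq hu⟩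

theorem IsMonicGegenbauer.isZonalGenerator_dilate {N : ℕ} (hN : 2 ≤ N) (i : Fin N) {a : ℝ}
    (ha : 0 < a) {m : ℕ} {p : Polynomial ℂ} (hp : IsMonicGegenbauer (((N : ℝ) - 2) / 2) m p) :
    IsZonalGenerator i a m (dilate a m p) := by
  rw [isZonalGenerator_iff hN i ha]
  have h := isRecurrenceSolution_dilate (isMonicGegenbauer_iff.mp hp) ha.ne'
  simpa only [div_one] using h

/-! ### The limit `N → ∞` -/

theorem tendsto_zonal_recurrence (m j : ℕ) :
    Tendsto (fun N : ℕ => ((m : ℂ) - j) * ((m : ℂ) + j + 2 * ((((N : ℝ) - 2) / 2 : ℝ) : ℂ)) /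
      ((Real.sqrt N : ℝ) : ℂ) ^ 2) atTop (𝓝 ((m : ℂ) - j)) := by
  -- With `2b = N - 2` and `a² = N`, the factor `(m + j + 2b) / a²` equals `(m + j - 2) / N + 1`.
  have h₁ : Tendsto (fun N : ℕ => ((m : ℂ) - j) * (((m : ℂ) + j - 2) * ((N : ℂ))⁻¹ + 1)) atTop
      (𝓝 (((m : ℂ) - j) * (((m : ℂ) + j - 2) * 0 + 1))) :=
    ((tendsto_inv_atTop_nhds_zero_nat (𝕜 := ℂ)).const_mul _ |>.add_const 1).const_mul _
  rw [mul_zero, zero_add, mul_one] at h₁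
  refine h₁.congr' ?_
  filter_upwards [eventually_ne_atTop 0] with N hN
  have hN' : (N : ℂ) ≠ 0 := by exact_mod_cast hN
  rw [← Complex.ofReal_pow, Real.sq_sqrt N.cast_nonneg]
  push_cast
  field_simp
  ring

theorem polyTendsto_hermiteC_of_isZonalGenerator {m : ℕ} {q : ℕ → Polynomial ℂ}
    (i : ∀ N : ℕ, 2 ≤ N → Fin N)
    (hq : ∀ (N : ℕ) (hN : 2 ≤ N), IsZonalGenerator (i N hN) (Real.sqrt N) m (q N)) :
    PolyTendsto q (hermiteC m) := by
  refine IsRecurrenceSolution.polyTendsto (u := fun N j => ((m : ℂ) - j) *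
      ((m : ℂ) + j + 2 * ((((N : ℝ) - 2) / 2 : ℝ) : ℂ)) / ((Real.sqrt N : ℝ) : ℂ) ^ 2) ?_
    (hermiteC_isRecurrenceSolution m)
    (fun j hj => sub_ne_zero.mpr (by exact_mod_cast hj.ne')) fun j _ => tendsto_zonal_recurrence m j
  filter_upwards [eventually_ge_atTop 2] with N hN
  exact (isZonalGenerator_iff hN _ (Real.sqrt_pos.mpr (by positivity))).mp (hq N hN)

theorem mainTheorem2 (m : ℕ) :
    -- the polynomial `q_m(a; X)` exists and is unique
    (∀ (N : ℕ) (hN : 2 ≤ N) (a : ℝ), 0 < a →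
      ∃! q : Polynomial ℂ, IsZonalGenerator (⟨0, by omega⟩ : Fin N) a m q) ∧
    -- the monic Gegenbauer polynomial exists and is unique
    (∀ b : ℝ, -(1 / 2) < b → ∃! p : Polynomial ℂ, IsMonicGegenbauer b m p) ∧
    -- `H_m` is the Gaussian-orthogonal component of `X ^ m`
    IsGaussianOrthogonalComponent m (hermiteC m) ∧
    -- `q_m(√N; X) → H_m(X)`
    (∀ q : ℕ → Polynomial ℂ,
      (∀ (N : ℕ) (hN : 2 ≤ N),
        IsZonalGenerator (⟨0, by omega⟩ : Fin N) (Real.sqrt N) m (q N)) →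
      PolyTendsto q (hermiteC m)) ∧
    -- `q_m(a; X) = a ^ m * C_m^{((N-2)/2)}(X / a)`
    (∀ (N : ℕ) (hN : 2 ≤ N) (a : ℝ), 0 < a → ∀ q p : Polynomial ℂ,
      IsZonalGenerator (⟨0, by omega⟩ : Fin N) a m q →
      IsMonicGegenbauer (((N : ℝ) - 2) / 2) m p → q = dilate a m p) ∧
    -- `N ^ (m/2) * C_m^{((N-2)/2)}(X / √N) → H_m(X)`
    (∀ p : ℕ → Polynomial ℂ,
      (∀ N : ℕ, 2 ≤ N → IsMonicGegenbauer (((N : ℝ) - 2) / 2) m (p N)) →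
      PolyTendsto (fun N => dilate (Real.sqrt N) m (p N)) (hermiteC m)) := by
  refine ⟨fun N hN a ha => existsUnique_isZonalGenerator hN _ ha m,
    fun b hb => existsUnique_isMonicGegenbauer hb m, hermiteC_isGaussianOrthogonalComponent m,
    fun q hq => polyTendsto_hermiteC_of_isZonalGenerator _ hq, fun N hN a ha q p hq hp =>
      (existsUnique_isZonalGenerator hN _ ha m).unique hq (hp.isZonalGenerator_dilate hN _ ha),
    fun p hp => polyTendsto_hermiteC_of_isZonalGenerator
      (fun N hN => ⟨0, by omega⟩) fun N hN =>
        (hp N hN).isZonalGenerator_dilate hN _ (Real.sqrt_pos.mpr (by positivity))⟩
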